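/- Let $p\in[2,\infty)$, let $X$ be a real Banach space and let $\omega$ be a bounded antisymmetric bilinear form on $X$. The Heisenberg group $\mathbb H(\omega)$ is $X\times\mathbb R$ with the product $(x,s)*(y,t)=(x+y,\,s+t+\omega(x,y))$. For $\lambda>0$ put $N_{\infty,\lambda}(x,s)=\max\{\|x\|,\lambda\sqrt{|s|}\}$ and $d_{\infty,\lambda}(g,h)=N_{\infty,\lambda}(h^{-1}g)$. A set $M$ with a (quasi-)metric $d$ satisfies the relaxed $p$-umbel inequality with constant $K>0$ if for all $w,z\in M$ and all sequences $(x_n)_{n\in\mathbb N}$ in $M$ $$\frac1{2^p}\inf_{n}d(w,x_n)^p+\frac1{K^p}\inf_{i}\liminf_{j\to\infty}d(x_i,x_j)^p\le\max\Big\{d(w,z)^p,\ \sup_n d(x_n,z)^p\Big\}.$$ (1) If the norm metric of $X$ satisfies the relaxed $p$-umbel inequality with constant $C>0$, then for every $\lambda>0$ such that $\lambda^2|\omega(x,y)|\le\|x\|\,\|y\|$ for all $x,y\in X$, the quasi-metric $d_{\infty,\lambda}$ on $\mathbb H(\omega)$ satisfies the relaxed $p$-umbel inequality with constant $\max\{C,\,2\cdot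 8^{1/p}\}$. In particular this holds for $d_{\infty,1}$ if $\omega$ is normalized by $\|\omega\|\le1$. (2) If $\omega\neq0$ and $X$ has property $(\beta_p)$, then $(\mathbb H(\omega),d_{cc})$ has umbel cotype $p$. Here $X$ has property $(\beta_p)$ if there is $c>0$ such that for all $t>0$, all $z$ and all sequences $(x_n)$ in the closed unit ball of $X$ with $\inf_{i\ne j}\|x_i-x_j\|\ge t$, there is $i_0$ with $\|\frac{z-x_{i_0}}2\|\le1-\frac{t^p}{c}$. The Carnot–Carathéodory distance $d_{cc}(g,h)$ is the infimum of the lengths of $\gamma$ over all horizontal curves $(\gamma,z)$ from $g$ to $h$, that is, pairs of Lipschitz curves $\gamma:[0,1]\to X$, $z:[0,1]\to\mathbb R$ such that for almost every $t$, $\gamma$ is differentiable at $t$ and $z'(t)=\omega(\gamma(t),\gamma'(t))$. For $h\ge0$, let $[\mathbb N]^{\le h}$ (resp. $[\mathbb N]^{h}$) be the set of increasing tuples of natural numbers of length at most $h$ (resp. exactly $h$); $[\mathbb N]^{\le h}$ is the vertex set of the countably branching tree $T^\omega_h$, in which every tuple is joined to its one-term extensions, with its graph metric. A metric space $(M,d)$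 has umbel cotype $p$ if there is $C>0$ such that for all $k\ge1$ and all $f:T^\omega_{2^k}\to M$ with Lipschitz constant $\mathrm{Lip}(f)\in[0,\infty]$, $$\sum_{s=1}^{k-1}\ \inf_{\bar n\in[\mathbb N]^{\le 2^k-2^s}}\ \inf_{i\neq j\in\mathbb N}\ \inf_{\substack{\bar m,\bar m'\in[\mathbb N]^{2^s-1}\\(\bar n,i,\bar m),(\bar n,j,\bar m')\in[\mathbb N]^{\le2^k}}}\frac{d\big(f(\bar n,i,\bar m),f(\bar n,j,\bar m')\big)^p}{2^{sp}}\le C^p\,\mathrm{Lip}(f)^p .$$ -/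

import Mathlib

open scoped ENNReal
open MeasureTheory

noncomputable section

/-- Property `(β_p)`: Rolewicz's property `(β)` with power type `p`, that is
`β(t) ≥ t ^ p / c` for some constant `c > 0`. -/
def HasPropertyBeta (X : Type*) [NormedAddCommGroup X] [NormedSpace ℝ X] (p : ℝ) : Prop :=
  ∃ c : ℝ, 0 < c ∧ ∀ t : ℝ, 0 < t → ∀ (z : X) (x : ℕ → X), ‖z‖ ≤ 1 → (∀ n, ‖x n‖ ≤ 1) →
    (∀ i j, i ≠ j → t ≤ ‖x i - x j‖) →
    ∃ i₀, ‖(1 / 2 : ℝ) • (z - x i₀)‖ ≤ 1 - t ^ p / c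

/-- The relaxed `p`-umbel inequality with constant `K` for a distance-like function `d`.
It is stated in `[0, ∞]` because the right-hand side is infinite for unbounded sequences. -/
def RelaxedUmbelInequality {M : Type*} (d : M → M → ℝ≥0∞) (p K : ℝ) : Prop :=
  ∀ (w z : M) (x : ℕ → M),
    (⨅ n, d w (x n) ^ p) / 2 ^ p
      + (⨅ i, Filter.liminf (fun j => d (x i) (x j) ^ p) Filter.atTop) / ENNReal.ofReal K ^ p
      ≤ max (d w z ^ p) (⨆ n, d (x n) z ^ p)

/-- Vertices of the countably branching tree of height `h`: finite subsets of `ℕ` with at most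
`h` elements, written as increasing lists. -/
def TreeVertex (h : ℕ) : Type :=
  {l : List ℕ // l.Pairwise (· < ·) ∧ l.length ≤ h}

/-- The countably branching tree of height `h`: a vertex `(n₁, …, n_l)` is joined to each of its
extensions `(n₁, …, n_l, n_{l+1})`. -/
def countablyBranchingTree (h : ℕ) : SimpleGraph (TreeVertex h) where
  Adj u v := (∃ a : ℕ, v.1 = u.1 ++ [a]) ∨ (∃ a : ℕ, u.1 = v.1 ++ [a])
  symm := ⟨fun _ _ huv => Or.symm huv⟩
  loopless := ⟨fun u hu => by
    rcases hu with ⟨a, ha⟩ | ⟨a, ha⟩ <;>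
    · have := congrArg List.length ha
      simp at this⟩

/-- The Lipschitz constant, in `[0, ∞]`, of a map from the tree with its graph metric. -/
def treeLip {M : Type*} (d : M → M → ℝ≥0∞) (h : ℕ) (f : TreeVertex h → M) : ℝ≥0∞ :=
  ⨆ (u : TreeVertex h) (v : TreeVertex h) (_ : u ≠ v),
    d (f u) (f v) / ((countablyBranchingTree h).dist u v : ℝ≥0∞)

/-- The infimum of `d (f (n, i, m)) (f (n, j, m')) ^ p / 2 ^ (s p)` over all `n` of length at most
`2 ^ k - 2 ^ s`, all `i ≠ j`, and all `m`, `m'` of length `2 ^ s - 1` for which the concatenations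
`(n, i, m)` and `(n, j, m')` are vertices of the tree of height `2 ^ k`. -/
def umbelTerm {M : Type*} (d : M → M → ℝ≥0∞) (p : ℝ) (k s : ℕ)
    (f : TreeVertex (2 ^ k) → M) : ℝ≥0∞ :=
  ⨅ (n : List ℕ) (_ : n.length ≤ 2 ^ k - 2 ^ s)
    (i : ℕ) (j : ℕ) (_ : i ≠ j)
    (m : List ℕ) (_ : m.length = 2 ^ s - 1)
    (m' : List ℕ) (_ : m'.length = 2 ^ s - 1)
    (u : TreeVertex (2 ^ k)) (_ : u.1 = n ++ i :: m)
    (v : TreeVertex (2 ^ k)) (_ : v.1 = n ++ j :: m'),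
    d (f u) (f v) ^ p / 2 ^ ((s : ℝ) * p)

/-- Umbel cotype `p`. -/
def HasUmbelCotype {M : Type*} (d : M → M → ℝ≥0∞) (p : ℝ) : Prop :=
  ∃ C : ℝ, 0 < C ∧ ∀ k : ℕ, 1 ≤ k → ∀ f : TreeVertex (2 ^ k) → M,
    ∑ s ∈ Finset.Icc 1 (k - 1), umbelTerm d p k s f
      ≤ ENNReal.ofReal C ^ p * treeLip d (2 ^ k) f ^ p

/-- The underlying set `X × ℝ` of the Heisenberg group over the bilinear form `ω`. -/
@[ext] structure Heisenberg {X : Type*} [NormedAddCommGroup X] [NormedSpace ℝ X]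
    (ω : X →L[ℝ] X →L[ℝ] ℝ) where
  /-- the component in `X` -/
  pt : X
  /-- the component in `ℝ` -/
  ht : ℝ

namespace Heisenberg

variable {X : Type*} [NormedAddCommGroup X] [NormedSpace ℝ X] {ω : X →L[ℝ] X →L[ℝ] ℝ}

/-- `(x, s) * (y, t) = (x + y, s + t + ω(x, y))`. -/
instance : Mul (Heisenberg ω) := ⟨fun g h => ⟨g.pt + h.pt, g.ht + h.ht + ω g.pt h.pt⟩⟩

/-- `(x, s)⁻¹ = (-x, -s)`, the inverse for the product above when `ω` is antisymmetric. -/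
instance : Inv (Heisenberg ω) := ⟨fun g => ⟨-g.pt, -g.ht⟩⟩

/-- The function `N_{∞,λ}(x, s) = max (‖x‖, λ √|s|)`. -/
def koranyiNorm (lam : ℝ) (g : Heisenberg ω) : ℝ := max ‖g.pt‖ (lam * √|g.ht|)

/-- The quasi-metric `d_{∞,λ}(g, h) = N_{∞,λ}(h⁻¹ g)`. -/
def koranyiDist (lam : ℝ) (g h : Heisenberg ω) : ℝ≥0∞ :=
  ENNReal.ofReal (koranyiNorm lam (h⁻¹ * g))

/-- `(γ, z)`, restricted to `[0, 1]`, is a horizontal curve: both components are Lipschitz, and for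
almost every `t`, `γ` is differentiable at `t` and `z'(t) = ω(γ(t), γ'(t))`. -/
structure IsHorizontalCurve (ω : X →L[ℝ] X →L[ℝ] ℝ) (γ : ℝ → X) (z : ℝ → ℝ) : Prop where
  lipschitz_fst : ∃ K, LipschitzOnWith K γ (Set.Icc 0 1)
  lipschitz_snd : ∃ K, LipschitzOnWith K z (Set.Icc 0 1)
  horizontal : ∀ᵐ t ∂(volume.restrict (Set.Icc (0 : ℝ) 1)),
    ∃ v : X, HasDerivAt γ v t ∧ HasDerivAt z (ω (γ t) v) t

/-- The Carnot–Carathéodory distance: the infimum of the horizontal lengths (the lengths of the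
`X`-components) of the horizontal curves from `g` to `h`. -/
def ccDist (g h : Heisenberg ω) : ℝ≥0∞ :=
  ⨅ (γ : ℝ → X) (z : ℝ → ℝ) (_ : IsHorizontalCurve ω γ z)
    (_ : γ 0 = g.pt ∧ z 0 = g.ht) (_ : γ 1 = h.pt ∧ z 1 = h.ht),
    eVariationOn γ (Set.Icc 0 1)

end Heisenberg

end

/-! Part (1). Let `a` bound the distances from `w` to the `x n` from below and let `b` bound the
mutual ones. After a left translation `z` is the identity, and `w` and all `x n` lie in the ball of
radius `R`. If for some `n` the height of `(x n)⁻¹ * w` accounts for `a`, then `a ^ 2 ≤ 3 * R ^ 2`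
instead of `4 * R ^ 2`, and this gain pays for the separation term. Otherwise the `X`-components
carry `a`, and the inequality of `X` applies once a subsequence has `b`-separated `X`-components.
Bounded heights cluster, so the only obstruction is that `ω (x i) (x j)` stays away from zero with a
fixed sign. `RelaxedUmbelInequality.not_forall_le_apply` excludes this: such a sequence is
separated, so the umbel inequality finds midpoints of strictly smaller norm, and midpoints over
successive blocks inherit the lower bound on `ω`. Iteration drives a `p`-th power of a norm below
zero.

Part (2). Property `(β_p)` gives the inequality for `X` by rescaling, hence for `koranyiDist`.
Applied to a vertex, a descendant and infinitely many descendants of that one, the inequality yields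
umbel cotype by doubling scales (`RelaxedUmbelInequality.sum_umbelTerm_mul_le`); symmetry is used,
the triangle inequality is not. Umbel cotype then passes to the equivalent distance `ccDist`: a
horizontal curve of length `L` gains height at most `‖ω‖ * L ^ 2`, and loops of length of order
`√|τ|` gain height `τ`. -/

noncomputable section

/-! ### The relaxed umbel inequality and antisymmetric forms -/

open Filter in
/-- The relaxed umbel inequality for a finite distance function, in terms of real bounds. -/
theorem relaxedUmbelInequality_ofReal_iff {M : Type*} {δ : M → M → ℝ} (hδ : ∀ g h, 0 ≤ δ g h)
    {p K : ℝ} (hp : 0 < p) (hK : 0 < K) :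
    RelaxedUmbelInequality (fun g h => ENNReal.ofReal (δ g h)) p K ↔
      ∀ (w z : M) (x : ℕ → M) (R a b : ℝ), 0 ≤ a → 0 ≤ b → δ w z ≤ R → (∀ n, δ (x n) z ≤ R) →
        (∀ n, a ≤ δ w (x n)) → (∀ i, ∀ᶠ j in atTop, b ≤ δ (x i) (x j)) →
        (a / 2) ^ p + (b / K) ^ p ≤ R ^ p := by
  have two : (2 : ℝ≥0∞) = ENNReal.ofReal 2 := by simp
  have hdiv : ∀ u v : ℝ, 0 ≤ u → 0 < v →
      ENNReal.ofReal u ^ p / ENNReal.ofReal v ^ p = ENNReal.ofReal ((u / v) ^ p) := by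
    intro u v hu hv
    rw [← ENNReal.div_rpow_of_nonneg _ _ hp.le, ← ENNReal.ofReal_div_of_pos hv,
      ENNReal.ofReal_rpow_of_nonneg (by positivity) hp.le]
  constructor
  · intro H w z x R a b ha hb hwz hxz hwx hxx
    have hR : 0 ≤ R := (hδ w z).trans hwz
    have h1 := H w z x
    have h2 : max (ENNReal.ofReal (δ w z) ^ p) (⨆ n, ENNReal.ofReal (δ (x n) z) ^ p)
        ≤ ENNReal.ofReal R ^ p := by
      refine max_le ?_ (iSup_le fun n => ?_)
      · gcongr
      · gcongr; exact hxz n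
    have h3 : ENNReal.ofReal a ^ p ≤ ⨅ n, ENNReal.ofReal (δ w (x n)) ^ p := by
      refine le_iInf fun n => ?_
      gcongr; exact hwx n
    have h4 : ENNReal.ofReal b ^ p ≤
        ⨅ i, liminf (fun j => ENNReal.ofReal (δ (x i) (x j)) ^ p) atTop := by
      refine le_iInf fun i => le_liminf_of_le (by isBoundedDefault) ?_
      filter_upwards [hxx i] with j hj
      gcongr
    have h5 : ENNReal.ofReal a ^ p / 2 ^ p + ENNReal.ofReal b ^ p / ENNReal.ofReal K ^ p
        ≤ ENNReal.ofReal R ^ p :=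
      (add_le_add (ENNReal.div_le_div_right h3 _) (ENNReal.div_le_div_right h4 _)).trans
        (h1.trans h2)
    rw [two, hdiv a 2 ha two_pos, hdiv b K hb hK, ENNReal.ofReal_rpow_of_nonneg hR hp.le,
      ← ENNReal.ofReal_add (by positivity) (by positivity),
      ENNReal.ofReal_le_ofReal_iff (by positivity)] at h5
    exact h5
  · intro H w z x
    beta_reduce
    by_cases htop : max (ENNReal.ofReal (δ w z) ^ p) (⨆ n, ENNReal.ofReal (δ (x n) z) ^ p) = ⊤
    · rw [htop]; exact le_top
    have hroot : ∀ y : ℝ≥0∞, y ≠ ⊤ → ∃ r : ℝ, 0 ≤ r ∧ y = ENNReal.ofReal r ^ p := by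
      intro y hy
      refine ⟨(y ^ (1 / p)).toReal, ENNReal.toReal_nonneg, ?_⟩
      rw [ENNReal.ofReal_toReal (ENNReal.rpow_ne_top_of_nonneg (by positivity) hy),
        ← ENNReal.rpow_mul, one_div_mul_cancel hp.ne', ENNReal.rpow_one]
    have hle : ∀ u v : ℝ, 0 ≤ v → (ENNReal.ofReal u ^ p ≤ ENNReal.ofReal v ^ p ↔ u ≤ v) := by
      intro u v hv
      rw [ENNReal.rpow_le_rpow_iff hp, ENNReal.ofReal_le_ofReal_iff hv]
    obtain ⟨R, hR, hRe⟩ := hroot _ htop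
    obtain ⟨a, ha, hae⟩ := hroot (⨅ n, ENNReal.ofReal (δ w (x n)) ^ p)
      (ne_top_of_le_ne_top (ENNReal.rpow_ne_top_of_nonneg hp.le ENNReal.ofReal_ne_top)
        (iInf_le _ 0))
    have key : ∀ b : ℝ, 0 ≤ b → (∀ i, ∀ᶠ j in atTop, b ≤ δ (x i) (x j)) →
        ENNReal.ofReal a ^ p / 2 ^ p + ENNReal.ofReal b ^ p / ENNReal.ofReal K ^ p
          ≤ ENNReal.ofReal R ^ p := by
      intro b hb hxx
      rw [two, hdiv a 2 ha two_pos, hdiv b K hb hK, ENNReal.ofReal_rpow_of_nonneg hR hp.le,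
        ← ENNReal.ofReal_add (by positivity) (by positivity)]
      refine ENNReal.ofReal_le_ofReal (H w z x R a b ha hb ?_ ?_ ?_ hxx)
      · rw [← hle _ _ hR, ← hRe]; exact le_max_left _ _
      · intro n
        rw [← hle _ _ hR, ← hRe]
        exact le_max_of_le_right (le_iSup (fun n => ENNReal.ofReal (δ (x n) z) ^ p) n)
      · intro n
        rw [← hle _ _ (hδ _ _), ← hae]
        exact iInf_le _ n
    rw [hRe, hae]
    have ha2 : ENNReal.ofReal a ^ p / 2 ^ p ≤ ENNReal.ofReal R ^ p := by
      have := key 0 le_rfl (fun i => Eventually.of_forall fun j => hδ _ _)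
      exact le_trans le_self_add this
    have hK0 : ENNReal.ofReal K ^ p ≠ 0 := by
      simp [ENNReal.rpow_eq_zero_iff, hK, hp]
    have hKt : ENNReal.ofReal K ^ p ≠ ⊤ :=
      ENNReal.rpow_ne_top_of_nonneg hp.le ENNReal.ofReal_ne_top
    rw [← ENNReal.le_sub_iff_add_le_left (ne_top_of_le_ne_top
      (ENNReal.rpow_ne_top_of_nonneg hp.le ENNReal.ofReal_ne_top) ha2) ha2,
      ENNReal.div_le_iff hK0 hKt]
    -- A liminf need not be an eventual lower bound, but every smaller value is.
    refine le_of_forall_lt fun β hβ => ?_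
    obtain ⟨β', hβ', hβ''⟩ := exists_between hβ
    refine hβ'.trans_le ?_
    obtain ⟨b, hb, rfl⟩ := hroot β' hβ''.ne_top
    rw [← ENNReal.div_le_iff hK0 hKt, ENNReal.le_sub_iff_add_le_left (ne_top_of_le_ne_top
      (ENNReal.rpow_ne_top_of_nonneg hp.le ENNReal.ofReal_ne_top) ha2) ha2]
    refine key b hb fun i => ?_
    have := eventually_lt_of_lt_liminf (hβ''.trans_le (iInf_le _ i))
    filter_upwards [this] with j hj
    exact (hle _ _ (hδ _ _)).1 hj.le

theorem edist_eq_ofReal_norm_sub {X : Type*} [NormedAddCommGroup X] :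
    (fun x y : X => edist x y) = fun x y => ENNReal.ofReal ‖x - y‖ := by
  funext x y
  rw [edist_dist, dist_eq_norm]

open Filter in
/-- Infinite Ramsey theorem along a nonprincipal filter: a relation that holds for eventually all
pairs holds for all pairs of some subsequence. -/
theorem exists_strictMono_forall_lt_of_eventually {U : Filter ℕ} [U.NeBot] (hU : U ≤ atTop)
    {r : ℕ → ℕ → Prop} (h : ∀ᶠ i in U, ∀ᶠ j in U, r i j) :
    ∃ φ : ℕ → ℕ, StrictMono φ ∧ ∀ m n, m < n → r (φ m) (φ n) := by
  obtain ⟨f, -, hf⟩ := exists_seq_of_forall_finset_exists (fun i => ∀ᶠ j in U, r i j)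
    (fun i j => i < j ∧ r i j) (by
      intro s hs
      have h1 : ∀ᶠ j in U, ∀ x ∈ s, r x j := (Filter.eventually_all_finset s).2 hs
      have h2 : ∀ᶠ j in U, ∀ x ∈ s, x < j :=
        (Filter.eventually_all_finset s).2 fun x _ => hU (eventually_gt_atTop x)
      obtain ⟨y, hy, hy1, hy2⟩ := (h.and (h1.and h2)).exists
      exact ⟨y, hy, fun x hx => ⟨hy2 x hx, hy1 x hx⟩⟩)
  exact ⟨f, fun m n hmn => (hf m n hmn).1, fun m n hmn => (hf m n hmn).2⟩

/-- A space satisfying the relaxed umbel inequality contains no bounded sequence that is uniformly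
separated from zero by an antisymmetric form: convex blocks of such a sequence would have smaller
and smaller norms. -/
theorem RelaxedUmbelInequality.not_forall_le_apply {X : Type*} [NormedAddCommGroup X]
    [NormedSpace ℝ X] {p C : ℝ} (hp : 0 < p) (hC : 0 < C)
    (hX : RelaxedUmbelInequality (fun x y : X => edist x y) p C)
    {ω : X →L[ℝ] X →L[ℝ] ℝ} (hω : ∀ x y, ω x y = -ω y x) {η R : ℝ} (hη : 0 < η)
    {y : ℕ → X} (hR : ∀ n, ‖y n‖ ≤ R) (hy : ∀ i j, i < j → η ≤ ω (y i) (y j)) : False := by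
  rw [edist_eq_ofReal_norm_sub,
    relaxedUmbelInequality_ofReal_iff (fun _ _ => norm_nonneg _) hp hC] at hX
  have hR0 : 0 ≤ R := (norm_nonneg _).trans (hR 0)
  set t : ℝ := η / (‖ω‖ * R + 1) with ht
  have ht0 : 0 < t := by positivity
  have hsep : ∀ u v : X, ‖u‖ ≤ R → η ≤ ω u v → t ≤ ‖u - v‖ := by
    intro u v hu huv
    by_contra! hlt
    have h0 : ω u u = 0 := by have := hω u u; linarith
    have h1 : ω u v = ω u (v - u) := by rw [map_sub, h0, sub_zero]
    have h2 : ω u (v - u) ≤ ‖ω‖ * R * ‖u - v‖ := by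
      refine (le_abs_self _).trans ((ω.le_opNorm₂ u (v - u)).trans ?_)
      rw [norm_sub_rev v u]
      gcongr
    have h3 : ‖ω‖ * R * ‖u - v‖ ≤ ‖ω‖ * R * t := by gcongr
    have h4 : (‖ω‖ * R + 1) * t = η := by rw [ht]; field_simp
    nlinarith
  -- Half of the gain in the umbel inequality, so that the failure of the midpoint bound is
  -- contradictory.
  set ε : ℝ := (t / C) ^ p / 2 with hε
  have hε0 : 0 < ε := by positivity
  have step : ∀ N : ℕ, ∃ y : ℕ → X, (∀ n, ‖y n‖ ≤ R) ∧ (∀ n, ‖y n‖ ^ p ≤ R ^ p - N * ε) ∧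
      ∀ i j, i < j → η ≤ ω (y i) (y j) := by
    intro N
    induction N with
    | zero =>
      refine ⟨y, hR, fun n => ?_, hy⟩
      simpa using Real.rpow_le_rpow (norm_nonneg _) (hR n) hp.le
    | succ N ih =>
      obtain ⟨y, hyR, hyN, hyω⟩ := ih
      have hQ : 0 ≤ R ^ p - N * ε := le_trans (by positivity) (hyN 0)
      have hstep : ∀ m, ∃ n, m < n ∧
          ‖(1 / 2 : ℝ) • (y m + y n)‖ ^ p ≤ R ^ p - (N + 1 : ℕ) * ε := by
        intro m
        by_contra! hcon
        set Q := R ^ p - N * ε with hQdef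
        set a : ℝ := 2 * (max (Q - ε) 0) ^ (1 / p) with ha
        have ha0 : 0 ≤ a := by positivity
        have hmax : ∀ v : X, ‖v‖ ^ p ≤ Q → ‖v‖ ≤ Q ^ (1 / p) := by
          intro v hv
          rw [one_div]
          exact (Real.le_rpow_inv_iff_of_pos (norm_nonneg _) hQ hp).2 hv
        -- The sign turns distances from `y m` into norms of sums, that is, twice the midpoints.
        have := hX (y m) 0 (fun n => -y (m + 1 + n)) (Q ^ (1 / p)) a t ha0 ht0.le
          (by simpa using hmax _ (hyN m)) (fun n => by simpa using hmax _ (hyN _))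
          (fun n => by
            have h1 := hcon (m + 1 + n) (by omega)
            rw [norm_smul] at h1
            rw [sub_neg_eq_add, ha]
            have h2 : (max (Q - ε) 0) ^ (1 / p) ≤ ‖(1 / 2 : ℝ)‖ * ‖y m + y (m + 1 + n)‖ := by
              rw [one_div, Real.rpow_inv_le_iff_of_pos (le_max_right _ _) (by positivity) hp]
              refine max_le (le_of_lt ?_) (by positivity)
              rw [hQdef]; push_cast at h1; linarith
            have h3 : ‖(1 / 2 : ℝ)‖ = 1 / 2 := by norm_num
            rw [h3] at h2
            linarith)
          (fun i => by
            filter_upwards [Filter.eventually_gt_atTop i] with j hj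
            have := hsep (y (m + 1 + i)) (y (m + 1 + j)) (hyR _) (hyω _ _ (by omega))
            rwa [neg_sub_neg, norm_sub_rev])
        have e1 : (a / 2) ^ p = max (Q - ε) 0 := by
          rw [ha, mul_div_cancel_left₀ _ two_ne_zero, ← Real.rpow_mul (le_max_right _ _),
            one_div_mul_cancel hp.ne', Real.rpow_one]
        have e2 : (Q ^ (1 / p)) ^ p = Q := by
          rw [← Real.rpow_mul hQ, one_div_mul_cancel hp.ne', Real.rpow_one]
        rw [e1, e2] at this
        have := le_max_left (Q - ε) 0
        linarith
      choose g hg hgN using hstep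
      -- Successive blocks `s i < g (s i) < s j` order all four cross pairs, so averaging preserves
      -- the bound `η`.
      obtain ⟨s, hs⟩ : ∃ s : ℕ → ℕ, ∀ i j, i < j → g (s i) < s j := by
        obtain ⟨s, -, hs⟩ := exists_seq_of_forall_finset_exists (fun _ : ℕ => True)
          (fun i j => g i < j) (fun F _ => ⟨F.sup g + 1, trivial, fun x hx =>
            Nat.lt_succ_of_le (Finset.le_sup (f := g) hx)⟩)
        exact ⟨s, hs⟩
      refine ⟨fun k => (1 / 2 : ℝ) • (y (s k) + y (g (s k))), fun n => ?_, fun n => hgN _, ?_⟩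
      · rw [norm_smul]
        have h3 : ‖(1 / 2 : ℝ)‖ = 1 / 2 := by norm_num
        have := norm_add_le (y (s n)) (y (g (s n)))
        have := hyR (s n)
        have := hyR (g (s n))
        rw [h3]; linarith
      · intro i j hij
        have h0 := hs i j hij
        have h1 := hg (s i)
        have h2 := hg (s j)
        have a1 := hyω (s i) (s j) (by omega)
        have a2 := hyω (s i) (g (s j)) (by omega)
        have a3 := hyω (g (s i)) (s j) (by omega)
        have a4 := hyω (g (s i)) (g (s j)) (by omega)
        simp only [map_smul, map_add, smul_apply,
          add_apply, smul_eq_mul]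
        linarith
  obtain ⟨N, hN⟩ := exists_nat_gt (R ^ p / ε)
  obtain ⟨y', -, h, -⟩ := step N
  have h1 : 0 ≤ ‖y' 0‖ ^ p := by positivity
  have h2 := h 0
  rw [div_lt_iff₀ hε0] at hN
  linarith

end

/-! ### The relaxed umbel inequality on the Heisenberg group -/

noncomputable section

namespace Heisenberg

variable {X : Type*} [NormedAddCommGroup X] [NormedSpace ℝ X] {ω : X →L[ℝ] X →L[ℝ] ℝ}

theorem pt_inv_mul (g h : Heisenberg ω) : (h⁻¹ * g).pt = g.pt - h.pt :=
  neg_add_eq_sub h.pt g.pt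

theorem ht_inv_mul (g h : Heisenberg ω) : (h⁻¹ * g).ht = g.ht - h.ht - ω h.pt g.pt := by
  change -h.ht + g.ht + ω (-h.pt) g.pt = _
  rw [map_neg, neg_apply]
  ring

theorem koranyiNorm_inv_mul (lam : ℝ) (g h : Heisenberg ω) :
    koranyiNorm lam (h⁻¹ * g) =
      max ‖g.pt - h.pt‖ (lam * √|g.ht - h.ht - ω h.pt g.pt|) := by
  rw [koranyiNorm, pt_inv_mul, ht_inv_mul]

theorem koranyiNorm_nonneg (lam : ℝ) (g : Heisenberg ω) : 0 ≤ koranyiNorm lam g :=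
  le_max_of_le_left (norm_nonneg _)

theorem koranyiNorm_inv_mul_comm (hω : ∀ x y, ω x y = -ω y x) (lam : ℝ) (g h : Heisenberg ω) :
    koranyiNorm lam (h⁻¹ * g) = koranyiNorm lam (g⁻¹ * h) := by
  rw [koranyiNorm_inv_mul, koranyiNorm_inv_mul, norm_sub_rev, hω g.pt h.pt,
    ← abs_neg (g.ht - h.ht - ω h.pt g.pt)]
  ring_nf

theorem koranyiNorm_inv_mul_left (hω : ∀ x y, ω x y = -ω y x) (lam : ℝ) (g h k : Heisenberg ω) :
    koranyiNorm lam ((k⁻¹ * h)⁻¹ * (k⁻¹ * g)) = koranyiNorm lam (h⁻¹ * g) := by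
  have h0 : ω k.pt k.pt = 0 := by have := hω k.pt k.pt; linarith
  rw [koranyiNorm_inv_mul, koranyiNorm_inv_mul, pt_inv_mul, pt_inv_mul, ht_inv_mul, ht_inv_mul,
    sub_sub_sub_cancel_right]
  simp only [map_sub, sub_apply, h0]
  rw [hω h.pt k.pt]
  ring_nf

theorem mul_sqrt_abs_le_iff {lam r : ℝ} (hlam : 0 ≤ lam) (hr : 0 ≤ r) (τ : ℝ) :
    lam * √|τ| ≤ r ↔ lam ^ 2 * |τ| ≤ r ^ 2 := by
  rw [← pow_le_pow_iff_left₀ (by positivity) hr two_ne_zero, mul_pow, Real.sq_sqrt (abs_nonneg τ)]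

theorem koranyiNorm_le_iff {lam r : ℝ} (hlam : 0 ≤ lam) (hr : 0 ≤ r) (g : Heisenberg ω) :
    koranyiNorm lam g ≤ r ↔ ‖g.pt‖ ≤ r ∧ lam ^ 2 * |g.ht| ≤ r ^ 2 := by
  rw [koranyiNorm, max_le_iff, mul_sqrt_abs_le_iff hlam hr]

/-- Two heights and one value of `ω` contribute `R ^ 2` each. That `3 < 4` is the gain in the
vertical case. -/
theorem sq_mul_abs_ht_inv_mul_le {lam R : ℝ} (hlam : 0 ≤ lam) (hR : 0 ≤ R)
    (hbd : ∀ x y, lam ^ 2 * |ω x y| ≤ ‖x‖ * ‖y‖) {g h : Heisenberg ω}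
    (hg : koranyiNorm lam g ≤ R) (hh : koranyiNorm lam h ≤ R) :
    lam ^ 2 * |(h⁻¹ * g).ht| ≤ 3 * R ^ 2 := by
  rw [koranyiNorm_le_iff hlam hR] at hg hh
  have h1 : |(h⁻¹ * g).ht| ≤ |g.ht| + |h.ht| + |ω h.pt g.pt| := by
    rw [ht_inv_mul]
    exact (abs_sub _ _).trans (by gcongr; exact abs_sub _ _)
  have h2 := hbd h.pt g.pt
  have h3 : ‖h.pt‖ * ‖g.pt‖ ≤ R * R := by gcongr; exacts [hh.1, hg.1]
  have h4 := mul_le_mul_of_nonneg_left h1 (sq_nonneg lam)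
  nlinarith [hg.2, hh.2]

theorem pt_norm_inv_mul_le {lam R : ℝ} {g h : Heisenberg ω}
    (hg : koranyiNorm lam g ≤ R) (hh : koranyiNorm lam h ≤ R) :
    ‖(h⁻¹ * g).pt‖ ≤ 2 * R := by
  rw [pt_inv_mul]
  have h1 := norm_sub_le g.pt h.pt
  have h2 := (le_max_left _ _).trans hg
  have h3 := (le_max_left _ _).trans hh
  linarith

open Filter in
/-- In a space satisfying the relaxed umbel inequality, the values of an antisymmetric form on
pairs of terms of a bounded sequence are small along a nonprincipal ultrafilter. -/
theorem _root_.RelaxedUmbelInequality.eventually_abs_apply_lt {p C : ℝ} (hp : 0 < p) (hC : 0 < C)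
    (hX : RelaxedUmbelInequality (fun x y : X => edist x y) p C)
    (hω : ∀ x y, ω x y = -ω y x) {U : Ultrafilter ℕ} (hU : (U : Filter ℕ) ≤ atTop) {ε R : ℝ}
    (hε : 0 < ε) {x : ℕ → X} (hR : ∀ n, ‖x n‖ ≤ R) :
    ∀ᶠ i in U, ∀ᶠ j in U, |ω (x i) (x j)| < ε := by
  by_contra hcon
  -- An ultrafilter commutes with negation and disjunction, so failure fixes one sign for almost all
  -- pairs.
  simp only [← Ultrafilter.eventually_not, not_lt, le_abs, Ultrafilter.eventually_or] at hcon
  rcases hcon with h | h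
  · obtain ⟨φ, -, hφ⟩ := exists_strictMono_forall_lt_of_eventually hU h
    exact hX.not_forall_le_apply hp hC hω hε (y := x ∘ φ) (fun n => hR _) hφ
  · obtain ⟨φ, -, hφ⟩ := exists_strictMono_forall_lt_of_eventually hU h
    exact hX.not_forall_le_apply (ω := -ω) hp hC (fun u v => by simp [hω u v]) hε (y := x ∘ φ)
      (fun n => hR _) hφ

open Filter Topology in
-- By compactness a bounded real sequence converges along an ultrafilter.
theorem _root_.Ultrafilter.eventually_abs_sub_lt (U : Ultrafilter ℕ) {ε R : ℝ}
    (hε : 0 < ε) {s : ℕ → ℝ} (hR : ∀ n, |s n| ≤ R) :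
    ∀ᶠ i in U, ∀ᶠ j in U, |s i - s j| < ε := by
  obtain ⟨l, -, hl⟩ := (isCompact_Icc (a := -R) (b := R)).ultrafilter_le_nhds (U.map s)
    (by
      rw [le_principal_iff, Ultrafilter.coe_map, mem_map]
      exact univ_mem' fun n => abs_le.1 (hR n))
  have hl' : Tendsto s U (𝓝 l) := hl
  have h := hl'.eventually (Metric.ball_mem_nhds l (half_pos hε))
  filter_upwards [h] with i hi
  filter_upwards [h] with j hj
  rw [← Real.dist_eq]
  linarith [dist_triangle_right (s i) (s j) l]

open Filter in
theorem relaxedUmbelInequality_koranyiDist (hω : ∀ x y, ω x y = -ω y x) {p C lam : ℝ}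
    (hp : 2 ≤ p) (hC : 0 < C) (hX : RelaxedUmbelInequality (fun x y : X => edist x y) p C)
    (hlam : 0 < lam) (hbd : ∀ x y, lam ^ 2 * |ω x y| ≤ ‖x‖ * ‖y‖) :
    RelaxedUmbelInequality (koranyiDist (ω := ω) lam) p (max C (2 * (8 : ℝ) ^ (1 / p))) := by
  have hp0 : 0 < p := by linarith
  have hX' := hX
  rw [edist_eq_ofReal_norm_sub,
    relaxedUmbelInequality_ofReal_iff (fun _ _ => norm_nonneg _) hp0 hC] at hX'
  set K := max C (2 * (8 : ℝ) ^ (1 / p)) with hK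
  have hK0 : 0 < K := lt_max_of_lt_left hC
  refine (relaxedUmbelInequality_ofReal_iff (δ := fun g h : Heisenberg ω => koranyiNorm lam (h⁻¹ * g))
    (fun _ _ => koranyiNorm_nonneg _ _) hp0 hK0).2 ?_
  intro w₀ z x₀ R a b ha hb hw hx hwx hxx
  obtain ⟨w, hwdef⟩ : ∃ w, w = z⁻¹ * w₀ := ⟨_, rfl⟩
  obtain ⟨x, hxdef⟩ : ∃ x : ℕ → Heisenberg ω, x = fun n => z⁻¹ * x₀ n := ⟨_, rfl⟩
  replace hw : koranyiNorm lam w ≤ R := by rwa [hwdef]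
  replace hx : ∀ n, koranyiNorm lam (x n) ≤ R := by rwa [hxdef]
  replace hwx : ∀ n, a ≤ koranyiNorm lam ((x n)⁻¹ * w) := by
    intro n
    rw [hwdef, hxdef, koranyiNorm_inv_mul_left hω]
    exact hwx n
  replace hxx : ∀ i, ∀ᶠ j in atTop, b ≤ koranyiNorm lam ((x j)⁻¹ * x i) := by
    intro i
    filter_upwards [hxx i] with j hj
    rw [hxdef, koranyiNorm_inv_mul_left hω]
    exact hj
  have hR : 0 ≤ R := (koranyiNorm_nonneg _ _).trans hw
  have hpt : ∀ {g : Heisenberg ω}, koranyiNorm lam g ≤ R → ‖g.pt‖ ≤ R :=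
    fun hg => (le_max_left _ _).trans hg
  by_cases hcase : ∃ n, a ≤ lam * √|((x n)⁻¹ * w).ht|
  · obtain ⟨n, hn⟩ := hcase
    have h1 := sq_mul_abs_ht_inv_mul_le hlam.le hR hbd hw (hx n)
    have h2 : (a / 2) ^ p ≤ 3 / 4 * R ^ p := by
      have h3 : (a / 2) ^ 2 ≤ 3 / 4 * R ^ 2 := by
        have : a ^ 2 ≤ lam ^ 2 * |((x n)⁻¹ * w).ht| := by
          rw [← Real.sq_sqrt (abs_nonneg ((x n)⁻¹ * w).ht), ← mul_pow]
          gcongr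
        linarith
      have h4 : ∀ u : ℝ, 0 ≤ u → u ^ p = (u ^ 2) ^ (p / 2) := by
        intro u hu
        rw [← Real.rpow_natCast_mul hu]
        congr 1
        push_cast; ring
      rw [h4 _ (by positivity), h4 R hR]
      calc ((a / 2) ^ 2) ^ (p / 2) ≤ (3 / 4 * R ^ 2) ^ (p / 2) := by gcongr
        _ = (3 / 4) ^ (p / 2) * (R ^ 2) ^ (p / 2) := Real.mul_rpow (by norm_num) (by positivity)
        _ ≤ 3 / 4 * (R ^ 2) ^ (p / 2) := by
          gcongr
          -- Here `p ≥ 2` enters: `(3 / 4) ^ (p / 2) ≤ 3 / 4`. With `R ^ p / 8` from the separation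
          -- term, the total stays below `R ^ p`.
          exact Real.rpow_le_self_of_le_one (by norm_num) (by norm_num) (by linarith)
    have h5 : b ≤ 2 * R := by
      obtain ⟨j, hj⟩ := (hxx 0).exists
      refine hj.trans ((koranyiNorm_le_iff hlam.le (by positivity) _).2
        ⟨pt_norm_inv_mul_le (hx _) (hx _), ?_⟩)
      have := sq_mul_abs_ht_inv_mul_le hlam.le hR hbd (hx 0) (hx j)
      nlinarith [sq_nonneg R]
    have h6 : (b / K) ^ p ≤ 1 / 8 * R ^ p := by
      calc (b / K) ^ p ≤ (2 * R / (2 * (8 : ℝ) ^ (1 / p))) ^ p := by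
            gcongr
            exact le_max_right _ _
        _ = 1 / 8 * R ^ p := by
          rw [mul_div_mul_left _ _ two_ne_zero, Real.div_rpow hR (by positivity),
            ← Real.rpow_mul (by norm_num), one_div_mul_cancel hp0.ne', Real.rpow_one]
          ring
    have : 0 ≤ R ^ p := by positivity
    linarith
  · push Not at hcase
    have hwx' : ∀ n, a ≤ ‖w.pt - (x n).pt‖ := by
      intro n
      have := hwx n
      rw [koranyiNorm, le_max_iff] at this
      rw [← pt_inv_mul]
      exact this.resolve_right (hcase n).not_ge
    have hKC : (b / K) ^ p ≤ (b / C) ^ p := by gcongr; exact le_max_left _ _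
    suffices h : ∃ φ : ℕ → ℕ, ∀ i, ∀ᶠ j in atTop, b ≤ ‖(x (φ i)).pt - (x (φ j)).pt‖ by
      obtain ⟨φ, hφ⟩ := h
      have := hX' w.pt 0 (fun n => (x (φ n)).pt) R a b ha hb (by simpa using hpt hw)
        (fun n => by simpa using hpt (hx _)) (fun n => hwx' _) hφ
      linarith
    rcases hb.eq_or_lt with rfl | hb
    · exact ⟨id, fun i => Eventually.of_forall fun j => norm_nonneg _⟩
    have hU : (hyperfilter ℕ : Filter ℕ) ≤ atTop := by
      rw [← Nat.cofinite_eq_atTop]; exact hyperfilter_le_cofinite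
    -- Heights and `ω` get half each of `b ^ 2 / lam ^ 2`, the height at which the vertical part
    -- reaches `b`.
    have hε : 0 < b ^ 2 / (2 * lam ^ 2) := by positivity
    have h1 := hX.eventually_abs_apply_lt hp0 hC hω hU hε (x := fun n => (x n).pt)
      (fun n => hpt (hx n))
    have h2 := (hyperfilter ℕ).eventually_abs_sub_lt hε (s := fun n => (x n).ht)
      (R := R ^ 2 / lam ^ 2) (fun n => by
        rw [le_div_iff₀ (by positivity), mul_comm]
        exact ((koranyiNorm_le_iff hlam.le hR _).1 (hx n)).2)
    obtain ⟨φ, -, hφ⟩ := exists_strictMono_forall_lt_of_eventually hU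
      (r := fun i j => b ≤ ‖(x i).pt - (x j).pt‖) (by
        filter_upwards [h1, h2] with i hi1 hi2
        filter_upwards [hi1, hi2, hU (hxx i)] with j hj1 hj2 hj
        have hj' : b ≤ koranyiNorm lam ((x j)⁻¹ * x i) := hj
        rw [koranyiNorm_inv_mul, le_max_iff] at hj'
        refine hj'.resolve_right fun hle => ?_
        have h3 : b ^ 2 ≤ lam ^ 2 * |(x i).ht - (x j).ht - ω (x j).pt (x i).pt| := by
          rw [← Real.sq_sqrt (abs_nonneg ((x i).ht - (x j).ht - ω (x j).pt (x i).pt)), ← mul_pow]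
          gcongr
        have h4 : |(x i).ht - (x j).ht - ω (x j).pt (x i).pt| < b ^ 2 / lam ^ 2 := by
          calc _ ≤ |(x i).ht - (x j).ht| + |ω (x j).pt (x i).pt| := abs_sub _ _
            _ = |(x i).ht - (x j).ht| + |ω (x i).pt (x j).pt| := by rw [hω (x j).pt, abs_neg]
            _ < b ^ 2 / (2 * lam ^ 2) + b ^ 2 / (2 * lam ^ 2) := add_lt_add hj2 hj1
            _ = b ^ 2 / lam ^ 2 := by field_simp; ring
        rw [lt_div_iff₀ (by positivity)] at h4
        linarith)
    exact ⟨φ, fun i => (eventually_gt_atTop i).mono fun j hj => hφ i j hj⟩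

end Heisenberg
end

/-! ### From the relaxed umbel inequality to umbel cotype -/

noncomputable section

theorem le_treeLip_of_adj {M : Type*} (d : M → M → ℝ≥0∞) (h : ℕ) (f : TreeVertex h → M)
    {u v : TreeVertex h} (huv : (countablyBranchingTree h).Adj u v) :
    d (f u) (f v) ≤ treeLip d h f := by
  have h1 : ((countablyBranchingTree h).dist u v : ℝ≥0∞) = 1 := by
    rw [SimpleGraph.dist_eq_one_iff_adj.2 huv]; simp
  refine le_trans ?_ (le_iSup₂_of_le u v (le_iSup_of_le huv.ne le_rfl))
  rw [h1, div_one]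

theorem umbelTerm_mul_le {M : Type*} (d : M → M → ℝ≥0∞) (p : ℝ) {k s : ℕ}
    (f : TreeVertex (2 ^ k) → M) {n m m' : List ℕ} (hn : n.length ≤ 2 ^ k - 2 ^ s) {i j : ℕ}
    (hij : i ≠ j) (hm : m.length = 2 ^ s - 1) (hm' : m'.length = 2 ^ s - 1)
    {u v : TreeVertex (2 ^ k)} (hu : u.1 = n ++ i :: m) (hv : v.1 = n ++ j :: m') :
    umbelTerm d p k s f * 2 ^ ((s : ℝ) * p) ≤ d (f u) (f v) ^ p := by
  refine ENNReal.mul_le_of_le_div ?_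
  unfold umbelTerm
  exact iInf₂_le_of_le n hn <| iInf_le_of_le i <| iInf₂_le_of_le j hij <|
    iInf₂_le_of_le m hm <| iInf₂_le_of_le m' hm' <| iInf₂_le_of_le u hu <| iInf₂_le v hv

/-- From every vertex that is high enough above the leaves one finds, in infinitely many branches,
a descendant `2 ^ s` generations below whose image has `p`-th power of the distance to the image of
the vertex at most `Q`. -/
def HasShortDescents {M : Type*} (d : M → M → ℝ≥0∞) (p : ℝ) {k : ℕ} (f : TreeVertex (2 ^ k) → M)
    (s : ℕ) (Q : ℝ≥0∞) : Prop :=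
  ∀ n : TreeVertex (2 ^ k), n.1.length ≤ 2 ^ k - 2 ^ s →
    ∃ᶠ j in Filter.atTop, ∃ (m : List ℕ) (v : TreeVertex (2 ^ k)),
      m.length = 2 ^ s - 1 ∧ v.1 = n.1 ++ j :: m ∧ d (f n) (f v) ^ p ≤ Q

theorem hasShortDescents_zero {M : Type*} (d : M → M → ℝ≥0∞) {p : ℝ} (hp : 0 ≤ p) {k : ℕ}
    (f : TreeVertex (2 ^ k) → M) : HasShortDescents d p f 0 (treeLip d (2 ^ k) f ^ p) := by
  intro n hn
  refine Filter.Eventually.frequently ?_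
  filter_upwards [Filter.eventually_gt_atTop (n.1.foldr max 0)] with j hj
  have hmem : ∀ (l : List ℕ), ∀ a ∈ l, a ≤ l.foldr max 0 := by
    intro l
    induction l with
    | nil => simp
    | cons b l ih =>
      intro a ha
      rw [List.foldr_cons]
      rcases List.mem_cons.1 ha with rfl | ha
      · exact le_max_left _ _
      · exact le_max_of_le_right (ih a ha)
  have hk : 0 < 2 ^ k := by positivity
  refine ⟨[], ⟨n.1 ++ [j], ?_, ?_⟩, rfl, rfl, ?_⟩
  · refine List.pairwise_append.2 ⟨n.2.1, List.pairwise_singleton _ _, fun a ha b hb => ?_⟩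
    rw [List.mem_singleton.1 hb]
    exact (hmem _ a ha).trans_lt hj
  · rw [List.length_append, List.length_singleton]
    rw [pow_zero] at hn
    omega
  · exact ENNReal.rpow_le_rpow (le_treeLip_of_adj d _ f (Or.inl ⟨j, rfl⟩)) hp

open Filter in
-- The umbel has handle `n`, centre `z` at `2 ^ s` generations below, and tips `2 ^ s` generations
-- below `z` in distinct branches. Both halves are short descents; the whole is a descent of `2 ^ (s
-- + 1)` generations, bounded below by `c`.
theorem RelaxedUmbelInequality.add_umbelTerm_le {M : Type*} {d : M → M → ℝ≥0∞}
    (hd : ∀ g h, d g h = d h g) {p K : ℝ} (H : RelaxedUmbelInequality d p K) {k s : ℕ}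
    (hs : s + 1 ≤ k) {f : TreeVertex (2 ^ k) → M} {Q c : ℝ≥0∞} (hQ : HasShortDescents d p f s Q)
    {n : TreeVertex (2 ^ k)} (hn : n.1.length ≤ 2 ^ k - 2 ^ (s + 1))
    (hc : ∀ᶠ j in atTop, ∀ (m : List ℕ) (v : TreeVertex (2 ^ k)),
      m.length = 2 ^ (s + 1) - 1 → v.1 = n.1 ++ j :: m → c ≤ d (f n) (f v) ^ p) :
    c / 2 ^ p + umbelTerm d p k s f * 2 ^ ((s : ℝ) * p) / ENNReal.ofReal K ^ p ≤ Q := by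
  have h1 : 2 ^ (s + 1) ≤ 2 ^ k := Nat.pow_le_pow_right two_pos hs
  have h2 : 2 ^ (s + 1) = 2 ^ s + 2 ^ s := by ring
  have h3 : 0 < 2 ^ s := by positivity
  obtain ⟨i, ⟨m, z, hm, hz, hzQ⟩, hi⟩ := ((hQ n (by omega)).and_eventually hc).exists
  have hzlen : z.1.length ≤ 2 ^ k - 2 ^ s := by
    rw [hz, List.length_append, List.length_cons, hm]; omega
  obtain ⟨φ, hφ, hφQ⟩ := extraction_of_frequently_atTop (hQ z hzlen)
  choose m' v hm' hv hvQ using hφQ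
  refine le_trans ?_ ((H (f n) (f z) (fun l => f (v l))).trans
    (max_le hzQ (iSup_le fun l => (hd _ _).symm ▸ hvQ l)))
  refine add_le_add (ENNReal.div_le_div_right (le_iInf fun l => ?_) _)
    (ENNReal.div_le_div_right (le_iInf fun l => ?_) _)
  · refine hi (m ++ φ l :: m' l) (v l) ?_ ?_
    · rw [List.length_append, List.length_cons, hm, hm']; omega
    · rw [hv, hz, List.append_assoc, List.cons_append]
  · refine le_liminf_of_le (by isBoundedDefault) ?_
    filter_upwards [eventually_gt_atTop l] with l' hl'
    exact umbelTerm_mul_le d p f hzlen (hφ hl').ne (hm' l) (hm' l') (hv l) (hv l')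

theorem ENNReal.div_add_le_of_forall_lt {T α β Q : ℝ≥0∞} (hα : α ≠ 0) (hα' : α ≠ ⊤)
    (h0 : β ≤ Q) (h : ∀ c < T, c / α + β ≤ Q) : T / α + β ≤ Q := by
  rcases eq_or_ne Q ⊤ with rfl | hQ
  · exact le_top
  have hβ : β ≠ ⊤ := ne_top_of_le_ne_top hQ h0
  rw [← ENNReal.le_sub_iff_add_le_right hβ h0, ENNReal.div_le_iff hα hα']
  refine le_of_forall_lt fun c hc => ?_
  obtain ⟨c', hc', hc''⟩ := exists_between hc
  refine hc'.trans_le ?_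
  rw [← ENNReal.div_le_iff hα hα', ENNReal.le_sub_iff_add_le_right hβ h0]
  exact h c' hc''

/-- If `T` is the bound forced at scale `s + 1`, no `c < T` admits short descents there. So some
vertex has only long descents in almost all branches, and the umbel at that vertex adds the term of
scale `s`. The factor `2 ^ p` between scales matches the loss `c / 2 ^ p`. -/
theorem RelaxedUmbelInequality.sum_umbelTerm_mul_le {M : Type*} {d : M → M → ℝ≥0∞}
    (hd : ∀ g h, d g h = d h g) {p K : ℝ} (H : RelaxedUmbelInequality d p K) {k : ℕ}
    {f : TreeVertex (2 ^ k) → M} (r : ℕ) : ∀ {s : ℕ} {Q : ℝ≥0∞}, s + r ≤ k →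
      HasShortDescents d p f s Q →
      (∑ i ∈ Finset.range r, umbelTerm d p k (s + i) f) *
        (2 ^ ((s : ℝ) * p) / ENNReal.ofReal K ^ p) ≤ Q := by
  induction r with
  | zero => intro s Q _ _; simp
  | succ r ih =>
    intro s Q hsr hQ
    have hpow : (2 : ℝ≥0∞) ^ (((s + 1 : ℕ) : ℝ) * p) = 2 ^ ((s : ℝ) * p) * 2 ^ p := by
      rw [← ENNReal.rpow_add _ _ two_ne_zero ENNReal.ofNat_ne_top]
      congr 1
      push_cast; ring
    have h2 : (2 : ℝ≥0∞) ^ p ≠ 0 := by simp [ENNReal.rpow_eq_zero_iff]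
    have h2' : (2 : ℝ≥0∞) ^ p ≠ ⊤ := by simp [ENNReal.rpow_eq_top_iff]
    set T : ℝ≥0∞ := (∑ i ∈ Finset.range r, umbelTerm d p k (s + 1 + i) f) *
        (2 ^ (((s + 1 : ℕ) : ℝ) * p) / ENNReal.ofReal K ^ p) with hT
    have key : T / 2 ^ p +
        umbelTerm d p k s f * 2 ^ ((s : ℝ) * p) / ENNReal.ofReal K ^ p ≤ Q := by
      refine ENNReal.div_add_le_of_forall_lt h2 h2' ?_ fun c hc => ?_
      · have := H.add_umbelTerm_le hd (s := s) (by omega) hQ (c := 0)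
          (n := ⟨[], List.Pairwise.nil, Nat.zero_le _⟩) (Nat.zero_le _)
          (Filter.Eventually.of_forall fun _ _ _ _ _ => zero_le)
        exact le_trans le_add_self this
      · have hcQ : ¬ HasShortDescents d p f (s + 1) c := fun h =>
          (ih (by omega) h).not_gt hc
        unfold HasShortDescents at hcQ
        push Not at hcQ
        obtain ⟨n, hn, hc'⟩ := hcQ
        refine H.add_umbelTerm_le hd (by omega) hQ hn ?_
        filter_upwards [hc'] with j hj m v hm hv
        exact (hj m v hm hv).le
    refine le_trans (le_of_eq ?_) key
    rw [Finset.sum_range_succ', add_mul, add_zero]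
    congr 1
    · rw [hT, hpow, div_eq_mul_inv _ ((2 : ℝ≥0∞) ^ p), mul_assoc]
      congr 1
      · exact Finset.sum_congr rfl fun i _ => by rw [add_assoc, add_comm 1 i]
      · rw [div_eq_mul_inv, div_eq_mul_inv, mul_assoc, mul_assoc, mul_comm (2 ^ p), mul_assoc,
          ENNReal.inv_mul_cancel h2 h2', mul_one]
    · rw [mul_div_assoc]

theorem RelaxedUmbelInequality.hasUmbelCotype {M : Type*} {d : M → M → ℝ≥0∞}
    (hd : ∀ g h, d g h = d h g) {p K : ℝ} (hp : 0 ≤ p) (hK : 0 < K)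
    (H : RelaxedUmbelInequality d p K) : HasUmbelCotype d p := by
  refine ⟨K, hK, fun k hk f => ?_⟩
  have h := H.sum_umbelTerm_mul_le hd k (by omega) (hasShortDescents_zero d hp f)
  have hK0 : ENNReal.ofReal K ^ p ≠ 0 := by
    simp [ENNReal.rpow_eq_zero_iff, hK]
  have hKt : ENNReal.ofReal K ^ p ≠ ⊤ :=
    ENNReal.rpow_ne_top_of_nonneg hp ENNReal.ofReal_ne_top
  simp only [zero_add, Nat.cast_zero, zero_mul, ENNReal.rpow_zero, mul_one_div] at h
  rw [ENNReal.div_le_iff hK0 hKt, mul_comm] at h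
  refine le_trans (Finset.sum_le_sum_of_subset fun s hs => ?_) h
  rw [Finset.mem_Icc] at hs
  exact Finset.mem_range.2 (by omega)

/-- Umbel cotype is invariant under bi-Lipschitz changes of the distance. -/
theorem HasUmbelCotype.of_equivalent {M : Type*} {d d' : M → M → ℝ≥0∞} {p A B : ℝ} (hp : 0 ≤ p)
    (hA : 0 < A) (hB : 0 < B) (h : HasUmbelCotype d p)
    (hdA : ∀ g h, d g h ≤ ENNReal.ofReal A * d' g h)
    (hdB : ∀ g h, d' g h ≤ ENNReal.ofReal B * d g h) : HasUmbelCotype d' p := by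
  obtain ⟨C, hC, h⟩ := h
  refine ⟨B * C * A, by positivity, fun k hk f => ?_⟩
  have hBt : ENNReal.ofReal B ^ p ≠ ⊤ :=
    ENNReal.rpow_ne_top_of_nonneg hp ENNReal.ofReal_ne_top
  have hB0 : ENNReal.ofReal B ^ p ≠ 0 := by
    simp [ENNReal.rpow_eq_zero_iff, hB]
  have h1 : ∀ s, umbelTerm d' p k s f ≤ ENNReal.ofReal B ^ p * umbelTerm d p k s f := by
    intro s
    rw [mul_comm, ← ENNReal.div_le_iff hB0 hBt]
    refine le_iInf₂ fun n hn => le_iInf fun i => le_iInf₂ fun j hij => le_iInf₂ fun m hm =>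
      le_iInf₂ fun m' hm' => le_iInf₂ fun u hu => le_iInf₂ fun v hv => ?_
    rw [ENNReal.div_le_iff hB0 hBt]
    refine (iInf₂_le_of_le n hn <| iInf_le_of_le i <| iInf₂_le_of_le j hij <|
      iInf₂_le_of_le m hm <| iInf₂_le_of_le m' hm' <| iInf₂_le_of_le u hu <|
      iInf₂_le v hv : umbelTerm d' p k s f ≤ _).trans ?_
    rw [mul_comm _ (ENNReal.ofReal B ^ p), ← mul_div_assoc, ← ENNReal.mul_rpow_of_nonneg _ _ hp]
    gcongr
    exact hdB _ _
  have h2 : treeLip d (2 ^ k) f ≤ ENNReal.ofReal A * treeLip d' (2 ^ k) f := by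
    refine iSup₂_le fun u v => iSup_le fun huv => ?_
    refine (ENNReal.div_le_div_right (hdA _ _) _).trans ?_
    rw [mul_div_assoc]
    gcongr
    exact le_iSup₂_of_le u v (le_iSup_of_le huv le_rfl)
  calc ∑ s ∈ Finset.Icc 1 (k - 1), umbelTerm d' p k s f
      ≤ ∑ s ∈ Finset.Icc 1 (k - 1), ENNReal.ofReal B ^ p * umbelTerm d p k s f :=
        Finset.sum_le_sum fun s _ => h1 s
    _ = ENNReal.ofReal B ^ p * ∑ s ∈ Finset.Icc 1 (k - 1), umbelTerm d p k s f :=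
        (Finset.mul_sum _ _ _).symm
    _ ≤ ENNReal.ofReal B ^ p *
        (ENNReal.ofReal C ^ p * (ENNReal.ofReal A * treeLip d' (2 ^ k) f) ^ p) := by
        gcongr
        refine (h k hk f).trans ?_
        gcongr
    _ = ENNReal.ofReal (B * C * A) ^ p * treeLip d' (2 ^ k) f ^ p := by
        rw [ENNReal.ofReal_mul (by positivity), ENNReal.ofReal_mul hB.le,
          ENNReal.mul_rpow_of_nonneg _ _ hp, ENNReal.mul_rpow_of_nonneg _ _ hp,
          ENNReal.mul_rpow_of_nonneg _ _ hp]
        ring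

end

/-! ### Property `(β_p)` and the relaxed umbel inequality -/

noncomputable section

open Filter Set Topology

/-- Property `(β_p)` implies the relaxed `p`-umbel inequality for the norm. -/
theorem HasPropertyBeta.exists_relaxedUmbelInequality {X : Type*} [NormedAddCommGroup X]
    [NormedSpace ℝ X] {p : ℝ} (hp : 1 ≤ p) (h : HasPropertyBeta X p) :
    ∃ C : ℝ, 0 < C ∧ RelaxedUmbelInequality (fun x y : X => edist x y) p C := by
  obtain ⟨c, hc, h⟩ := h
  have hp0 : 0 < p := by linarith
  refine ⟨c ^ (1 / p), by positivity, ?_⟩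
  rw [edist_eq_ofReal_norm_sub,
    relaxedUmbelInequality_ofReal_iff (fun _ _ => norm_nonneg _) hp0 (by positivity)]
  intro w z x R a b ha hb hw hx hwx hxx
  have hR : 0 ≤ R := (norm_nonneg _).trans hw
  rcases hb.eq_or_lt with rfl | hb
  · rw [zero_div, Real.zero_rpow hp0.ne', add_zero]
    gcongr
    have h1 := hwx 0
    have h2 := hx 0
    have h3 := norm_sub_le_norm_sub_add_norm_sub w z (x 0)
    rw [norm_sub_rev z] at h3
    linarith
  obtain ⟨φ, hφ, hφb⟩ := exists_strictMono_forall_lt_of_eventually (le_refl atTop)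
    (Eventually.of_forall hxx)
  have hsep : ∀ i j, i ≠ j → b ≤ ‖x (φ i) - x (φ j)‖ := by
    intro i j hij
    rcases hij.lt_or_gt with h' | h'
    · exact hφb _ _ h'
    · rw [norm_sub_rev]; exact hφb _ _ h'
  have hR0 : 0 < R := by
    refine hR.lt_of_ne fun hR0 => ?_
    have h1 := hsep 0 1 zero_ne_one
    have h2 := norm_sub_le_norm_sub_add_norm_sub (x (φ 0)) z (x (φ 1))
    rw [norm_sub_rev z] at h2
    have := hx (φ 0)
    have := hx (φ 1)
    linarith
  have hscale : ∀ v : X, ‖R⁻¹ • v‖ = ‖v‖ / R := by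
    intro v
    rw [norm_smul, norm_inv, Real.norm_of_nonneg hR, inv_mul_eq_div]
  obtain ⟨i, hi⟩ := h (b / R) (by positivity) (R⁻¹ • (w - z)) (fun n => R⁻¹ • (x (φ n) - z))
    (by rw [hscale, div_le_one hR0]; exact hw)
    (fun n => by rw [hscale, div_le_one hR0]; exact hx _)
    (fun i j hij => by
      rw [← smul_sub, hscale, sub_sub_sub_cancel_right]
      gcongr
      exact hsep i j hij)
  rw [← smul_sub, sub_sub_sub_cancel_right, norm_smul, hscale] at hi
  have hhalf : ‖(1 / 2 : ℝ)‖ = 1 / 2 := by norm_num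
  rw [hhalf] at hi
  have h1 : a / 2 / R ≤ 1 - (b / R) ^ p / c := by
    refine le_trans ?_ hi
    rw [div_div, mul_comm 2 R, ← div_div, one_div_mul_eq_div]
    gcongr
    exact hwx _
  have h2 : (a / 2 / R) ^ p ≤ 1 - (b / R) ^ p / c := by
    -- For `θ` in `[0, 1]` and `p ≥ 1`, `θ ^ p ≤ θ`.
    refine (Real.rpow_le_rpow (by positivity) h1 hp0.le).trans
      (Real.rpow_le_self_of_le_one (le_trans (by positivity) h1) ?_ hp)
    have : 0 ≤ (b / R) ^ p / c := by positivity
    linarith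
  have hRp : 0 < R ^ p := by positivity
  rw [Real.div_rpow (by positivity) hR, Real.div_rpow hb.le hR] at h2
  rw [Real.div_rpow hb.le (by positivity), ← Real.rpow_mul hc.le, one_div_mul_cancel hp0.ne',
    Real.rpow_one]
  have h3 : ((a / 2) ^ p + b ^ p / c) / R ^ p ≤ 1 := by
    rw [add_div, div_right_comm (b ^ p)]; linarith
  rwa [div_le_one hRp] at h3

/-- The speed of a curve is bounded by the derivative of a monotone function whose increments
dominate those of the curve. -/
theorem norm_le_deriv_of_dist_le {X : Type*} [NormedAddCommGroup X] [NormedSpace ℝ X]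
    {γ : ℝ → X} {V : ℝ → ℝ} {t V' : ℝ} {v : X} {s : Set ℝ} (hs : s ∈ 𝓝 t)
    (hγV : ∀ x ∈ s, ∀ y ∈ s, x ≤ y → dist (γ x) (γ y) ≤ V y - V x) (hγ : HasDerivAt γ v t)
    (hV : HasDerivAt V V' t) : ‖v‖ ≤ V' := by
  rw [hasDerivAt_iff_tendsto_slope] at hγ hV
  refine le_of_tendsto_of_tendsto hγ.norm hV ?_
  filter_upwards [mem_nhdsWithin_of_mem_nhds hs] with y hy
  have ht := mem_of_mem_nhds hs
  rw [slope_def_module, slope_def_field, norm_smul, norm_inv, Real.norm_eq_abs, inv_mul_eq_div,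
    ← dist_eq_norm]
  rcases le_total t y with h | h
  · rw [abs_of_nonneg (sub_nonneg.2 h), dist_comm]
    exact div_le_div_of_nonneg_right (hγV t ht y hy h) (sub_nonneg.2 h)
  · rw [abs_of_nonpos (sub_nonpos.2 h), neg_sub, ← neg_sub (V t), ← neg_sub t y, neg_div_neg_eq]
    exact div_le_div_of_nonneg_right (hγV y hy t ht h) (sub_nonneg.2 h)

/-! ### Comparison with the Carnot–Carathéodory distance -/

namespace Heisenberg

variable {X : Type*} [NormedAddCommGroup X] [NormedSpace ℝ X] {ω : X →L[ℝ] X →L[ℝ] ℝ}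

/-- The vertical displacement of a horizontal curve is bounded by the square of its length. -/
theorem IsHorizontalCurve.abs_sub_le (hω : ∀ x y, ω x y = -ω y x) {γ : ℝ → X} {z : ℝ → ℝ}
    (h : IsHorizontalCurve ω γ z) :
    |z 1 - z 0 - ω (γ 0) (γ 1)| ≤ ‖ω‖ * (eVariationOn γ (Icc 0 1)).toReal ^ 2 := by
  obtain ⟨K₁, hK₁⟩ := h.lipschitz_fst
  obtain ⟨K₂, hK₂⟩ := h.lipschitz_snd
  set I : Set ℝ := Icc 0 1 with hI
  have h0I : (0 : ℝ) ∈ I := by simp [hI]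
  have h1I : (1 : ℝ) ∈ I := by simp [hI]
  have huI : uIcc (0 : ℝ) 1 = I := uIcc_of_le zero_le_one
  have hbv : LocallyBoundedVariationOn γ I := hK₁.locallyBoundedVariationOn
  set V : ℝ → ℝ := variationOnFromTo γ I 0 with hV
  have hVmono : MonotoneOn V (uIcc 0 1) := huI ▸ variationOnFromTo.monotoneOn hbv h0I
  have hVI : ∀ t ∈ I, V t ≤ (eVariationOn γ I).toReal := by
    intro t ht
    rw [hV, variationOnFromTo.eq_of_le γ I ht.1]
    refine ENNReal.toReal_mono ?_ (eVariationOn.mono γ inter_subset_left)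
    have := hbv 0 1 h0I h1I
    rwa [hI, inter_self] at this
  have hγV : ∀ x ∈ I, ∀ y ∈ I, x ≤ y → dist (γ x) (γ y) ≤ V y - V x := by
    intro x hx y hy hxy
    have h1 : V x + variationOnFromTo γ I x y = V y := variationOnFromTo.add hbv h0I hx hy
    rw [← h1, add_sub_cancel_left, variationOnFromTo.eq_of_le γ I hxy, dist_edist]
    exact ENNReal.toReal_mono (hbv x y hx hy)
      (eVariationOn.edist_le γ ⟨hx, left_mem_Icc.2 hxy⟩ ⟨hy, right_mem_Icc.2 hxy⟩)
  set L := (eVariationOn γ I).toReal with hL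
  have hL0 : 0 ≤ L := ENNReal.toReal_nonneg
  have hV0 : V 0 = 0 := variationOnFromTo.self γ I 0
  -- Almost everywhere `u' = ω (γ - γ 0) γ'`, at most `‖ω‖ * L` times the speed. Only this real
  -- function is integrated.
  set u : ℝ → ℝ := z - (ω (γ 0)) ∘ γ with hu
  have huac : AbsolutelyContinuousOnInterval u 0 1 := by
    refine AbsolutelyContinuousOnInterval.sub ?_ ?_
    · exact LipschitzOnWith.absolutelyContinuousOnInterval (K := K₂) (huI.symm ▸ hK₂)
    · exact LipschitzOnWith.absolutelyContinuousOnInterval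
        (huI.symm ▸ (ω (γ 0)).lipschitz.comp_lipschitzOnWith hK₁)
  have hVdiff : ∀ᵐ t : ℝ, t ∈ uIcc (0 : ℝ) 1 → DifferentiableAt ℝ V t :=
    BoundedVariationOn.ae_differentiableAt_of_mem_uIcc (by
      rw [huI]
      have := (huI ▸ hVmono : MonotoneOn V I).locallyBoundedVariationOn 0 1 h0I h1I
      rwa [hI, inter_self] at this)
  have hhor := h.horizontal
  rw [ae_restrict_iff' measurableSet_Icc] at hhor
  have hbound : ∀ᵐ t : ℝ, t ∈ Ioc (0 : ℝ) 1 → ‖deriv u t‖ ≤ ‖ω‖ * L * deriv V t := by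
    have hne : ∀ᵐ t : ℝ, t ≠ 1 := by simp [ae_iff, measure_singleton]
    filter_upwards [hVdiff, hhor, hne] with t htV hth ht1 ht
    have htI : t ∈ I := ⟨ht.1.le, ht.2⟩
    obtain ⟨v, hv, hz⟩ := hth htI
    have hmem : I ∈ 𝓝 t := Icc_mem_nhds ht.1 (lt_of_le_of_ne ht.2 ht1)
    have h1 : ‖v‖ ≤ deriv V t :=
      norm_le_deriv_of_dist_le hmem hγV hv (htV (huI.symm ▸ htI)).hasDerivAt
    have h2 : HasDerivAt u (ω (γ t) v - ω (γ 0) v) t :=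
      hz.sub ((ω (γ 0)).hasFDerivAt.comp_hasDerivAt t hv)
    rw [h2.deriv, ← sub_apply, ← map_sub]
    refine (ω.le_opNorm₂ _ _).trans ?_
    have h3 : ‖γ t - γ 0‖ ≤ L := by
      rw [← dist_eq_norm, dist_comm]
      have := hγV 0 h0I t htI ht.1.le
      have := hVI t htI
      linarith
    gcongr
  have hint := hVmono.intervalIntegrable_deriv
  have h1 := intervalIntegral.norm_integral_le_of_norm_le zero_le_one hbound
    (hint.const_mul (‖ω‖ * L))
  rw [huac.integral_deriv_eq_sub, intervalIntegral.integral_const_mul] at h1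
  -- For a monotone function this inequality needs no absolute continuity.
  have h2 : ∫ t in (0 : ℝ)..1, deriv V t ≤ L := by
    have h3 := hVmono.intervalIntegral_deriv_mem_uIcc
    have h4 := hVI 1 h1I
    have h5 : 0 ≤ V 1 := hV0 ▸ hVmono left_mem_uIcc right_mem_uIcc zero_le_one
    rw [hV0, sub_zero, uIcc_of_le h5] at h3
    exact h3.2.trans h4
  have h00 : ω (γ 0) (γ 0) = 0 := by have := hω (γ 0) (γ 0); linarith
  have h6 : u 1 - u 0 = z 1 - z 0 - ω (γ 0) (γ 1) := by
    simp only [hu, Pi.sub_apply, Function.comp_apply, h00]; ring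
  rw [h6, Real.norm_eq_abs] at h1
  calc _ ≤ _ := h1
    _ ≤ ‖ω‖ * L * L := by gcongr
    _ = ‖ω‖ * L ^ 2 := by ring

theorem koranyiDist_le_ccDist (hω : ∀ x y, ω x y = -ω y x) {lam : ℝ} (hlam : 0 ≤ lam)
    (hbd : lam ^ 2 * ‖ω‖ ≤ 1) (g h : Heisenberg ω) : koranyiDist lam g h ≤ ccDist g h := by
  refine le_iInf₂ fun γ z => le_iInf fun hγ => le_iInf₂ fun hg hh => ?_
  have htop : eVariationOn γ (Icc 0 1) ≠ ⊤ := by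
    obtain ⟨K, hK⟩ := hγ.lipschitz_fst
    have := hK.locallyBoundedVariationOn 0 1 (by simp) (by simp)
    rwa [inter_self] at this
  rw [koranyiDist, koranyiNorm_inv_mul_comm hω,
    ENNReal.ofReal_le_iff_le_toReal htop, koranyiNorm_le_iff hlam ENNReal.toReal_nonneg,
    pt_inv_mul, ht_inv_mul]
  constructor
  · rw [← hg.1, ← hh.1, ← dist_eq_norm, dist_edist]
    exact ENNReal.toReal_mono htop (eVariationOn.edist_le γ (by simp) (by simp))
  · have h1 := hγ.abs_sub_le hω
    rw [hg.1, hg.2, hh.1, hh.2] at h1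
    calc lam ^ 2 * |h.ht - g.ht - ω g.pt h.pt|
        ≤ lam ^ 2 * (‖ω‖ * (eVariationOn γ (Icc 0 1)).toReal ^ 2) := by gcongr
      _ = (lam ^ 2 * ‖ω‖) * (eVariationOn γ (Icc 0 1)).toReal ^ 2 := by ring
      _ ≤ 1 * (eVariationOn γ (Icc 0 1)).toReal ^ 2 := by gcongr
      _ = _ := one_mul _

/-- A line segment perturbed by a closed loop with vanishing mean in the plane spanned by `e` and
`f`. -/
def loopCurve (x v e f : X) (α β t : ℝ) : X :=
  x + t • v + (α * (t - 3 * t ^ 2 + 2 * t ^ 3)) • e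
    + (β * (1 / 5 * t - 6 / 5 * t ^ 2 + 2 * t ^ 3 - t ^ 4)) • f

/-- The height of the horizontal lift of `loopCurve` that starts at height `s`. -/
def loopHeight (ω : X →L[ℝ] X →L[ℝ] ℝ) (x v e f : X) (s α β t : ℝ) : ℝ :=
  s + t * ω x v + α * (t - 3 * t ^ 2 + 2 * t ^ 3) * ω x e
    + β * (1 / 5 * t - 6 / 5 * t ^ 2 + 2 * t ^ 3 - t ^ 4) * ω x f
    + α * (-1 * t ^ 3 + t ^ 4) * ω v e
    + β * (-2 / 5 * t ^ 3 + t ^ 4 - 3 / 5 * t ^ 5) * ω v f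
    + α * β * (-1 / 5 * t ^ 3 + 4 / 5 * t ^ 4 - 33 / 25 * t ^ 5 + t ^ 6 - 2 / 7 * t ^ 7) * ω e f

theorem hasDerivAt_const_mul_pow (c : ℝ) (n : ℕ) (t : ℝ) :
    HasDerivAt (fun t : ℝ => c * t ^ n) (c * (n * t ^ (n - 1))) t :=
  (hasDerivAt_pow n t).const_mul c

theorem hasDerivAt_loopCurve (x v e f : X) (α β t : ℝ) :
    HasDerivAt (loopCurve x v e f α β)
      (v + (α * (1 - 6 * t + 6 * t ^ 2)) • e
        + (β * (1 / 5 - 12 / 5 * t + 6 * t ^ 2 - 4 * t ^ 3)) • f) t := by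
  have hP := hasDerivAt_const_mul_pow
  have ha : HasDerivAt (fun t : ℝ => α * (t - 3 * t ^ 2 + 2 * t ^ 3))
      (α * (1 - 6 * t + 6 * t ^ 2)) t := by
    convert! (((hasDerivAt_id t).sub (hP 3 2 t)).add (hP 2 3 t)).const_mul α using 1
    push_cast; ring
  have hb : HasDerivAt (fun t : ℝ => β * (1 / 5 * t - 6 / 5 * t ^ 2 + 2 * t ^ 3 - t ^ 4))
      (β * (1 / 5 - 12 / 5 * t + 6 * t ^ 2 - 4 * t ^ 3)) t := by
    convert! (((((hasDerivAt_id t).const_mul (1 / 5)).sub (hP (6 / 5) 2 t)).add (hP 2 3 t)).sub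
      (hasDerivAt_pow 4 t)).const_mul β using 1
    push_cast; ring
  have := ((((hasDerivAt_id t).smul_const v).const_add x).add (ha.smul_const e)).add
    (hb.smul_const f)
  rwa [one_smul] at this

/-- Writing `a`, `b` for the coefficients of `e`, `f`, the last three terms integrate `t a' - a`, `t
b' - b` and `a b' - a' b`. The first two vanish at `1` because the loop is closed with mean zero. -/
theorem hasDerivAt_loopHeight (hω : ∀ x y, ω x y = -ω y x) (x v e f : X) (s α β t : ℝ) :
    HasDerivAt (loopHeight ω x v e f s α β)
      (ω (loopCurve x v e f α β t) (v + (α * (1 - 6 * t + 6 * t ^ 2)) • e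
        + (β * (1 / 5 - 12 / 5 * t + 6 * t ^ 2 - 4 * t ^ 3)) • f)) t := by
  have hP := hasDerivAt_const_mul_pow
  have hp := fun n => hasDerivAt_pow n t
  have hself : ∀ y, ω y y = 0 := fun y => by have := hω y y; linarith
  have h1 := ((hasDerivAt_id t).mul_const (ω x v)).const_add s
  have h2 := ((((hasDerivAt_id t).sub (hP 3 2 t)).add (hP 2 3 t)).const_mul α).mul_const (ω x e)
  have h3 := ((((((hasDerivAt_id t).const_mul (1 / 5)).sub (hP (6 / 5) 2 t)).add (hP 2 3 t)).sub
      (hp 4)).const_mul β).mul_const (ω x f)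
  have h4 := (((hP (-1) 3 t).add (hp 4)).const_mul α).mul_const (ω v e)
  have h5 := ((((hP (-2 / 5) 3 t).add (hp 4)).sub (hP (3 / 5) 5 t)).const_mul β).mul_const (ω v f)
  have h6 := ((((((hP (-1 / 5) 3 t).add (hP (4 / 5) 4 t)).sub (hP (33 / 25) 5 t)).add
    (hp 6)).sub (hP (2 / 7) 7 t)).const_mul (α * β)).mul_const (ω e f)
  convert! ((((h1.add h2).add h3).add h4).add h5).add h6 using 1
  simp only [loopCurve, map_add, map_smul, add_apply, smul_apply, smul_eq_mul, hself, hω e v,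
    hω f v, hω f e]
  push_cast
  ring

theorem isHorizontalCurve_loop (hω : ∀ x y, ω x y = -ω y x) (x v e f : X) (s α β : ℝ) :
    IsHorizontalCurve ω (loopCurve x v e f α β) (loopHeight ω x v e f s α β) := by
  refine ⟨?_, ?_, Eventually.of_forall fun t =>
    ⟨_, hasDerivAt_loopCurve x v e f α β t, hasDerivAt_loopHeight hω x v e f s α β t⟩⟩
  · exact ContDiffOn.exists_lipschitzOnWith (n := 1) (by unfold loopCurve; fun_prop) one_ne_zero
      (convex_Icc _ _) isCompact_Icc
  · exact ContDiffOn.exists_lipschitzOnWith (n := 1) (by unfold loopHeight; fun_prop) one_ne_zero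
      (convex_Icc _ _) isCompact_Icc

theorem eVariationOn_loopCurve_le (x v e f : X) (α β : ℝ) :
    eVariationOn (loopCurve x v e f α β) (Icc 0 1)
      ≤ ENNReal.ofReal (‖v‖ + |α| * 13 * ‖e‖ + |β| * 13 * ‖f‖) := by
  set C : NNReal := Real.toNNReal (‖v‖ + |α| * 13 * ‖e‖ + |β| * 13 * ‖f‖) with hC
  have hlip : LipschitzOnWith C (loopCurve x v e f α β) (Icc 0 1) := by
    refine (convex_Icc (0 : ℝ) 1).lipschitzOnWith_of_nnnorm_hasDerivWithin_le
      (fun t _ => (hasDerivAt_loopCurve x v e f α β t).hasDerivWithinAt) fun t ht => ?_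
    rw [← NNReal.coe_le_coe, coe_nnnorm, hC, Real.coe_toNNReal _ (by positivity)]
    have h2 : 0 ≤ t ^ 2 ∧ t ^ 2 ≤ 1 := ⟨pow_nonneg ht.1 _, pow_le_one₀ ht.1 ht.2⟩
    have h3 : 0 ≤ t ^ 3 ∧ t ^ 3 ≤ 1 := ⟨pow_nonneg ht.1 _, pow_le_one₀ ht.1 ht.2⟩
    refine (norm_add₃_le).trans ?_
    rw [norm_smul, norm_smul, Real.norm_eq_abs, Real.norm_eq_abs, abs_mul, abs_mul]
    gcongr
    · rw [abs_le]; constructor <;> linarith [ht.1, ht.2]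
    · rw [abs_le]; constructor <;> linarith [ht.1, ht.2]
  have h1 := hlip.comp_eVariationOn_le (g := id) (mapsTo_id _)
  have h2 := (monotoneOn_id (s := Icc (0 : ℝ) 1)).eVariationOn_eq (a := 0) (b := 1)
    (by simp) (by simp)
  rw [inter_self] at h2
  calc _ ≤ _ := h1
    _ = C * ENNReal.ofReal (id 1 - id 0) := by rw [h2]
    _ = _ := by simp [hC, ENNReal.ofReal]

theorem exists_ccDist_le (hω : ∀ x y, ω x y = -ω y x) (hω0 : ω ≠ 0) {lam : ℝ} (hlam : 0 < lam) :
    ∃ B : ℝ, 0 < B ∧ ∀ g h : Heisenberg ω, ccDist g h ≤ ENNReal.ofReal B * koranyiDist lam g h := by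
  -- The coefficient of `ω e f` in `loopHeight` at `t = 1` is `-α * β / 175`, so this scaling makes
  -- the loop gain exactly `α * β`.
  obtain ⟨e, f, hef⟩ : ∃ e f, ω e f = -175 := by
    have : ∃ e f, ω e f ≠ 0 := by
      by_contra! hcon
      exact hω0 (by ext x y; simpa using hcon x y)
    obtain ⟨e, f, hef⟩ := this
    exact ⟨e, (-175 / ω e f) • f, by rw [map_smul, smul_eq_mul, div_mul_cancel₀ _ hef]⟩
  refine ⟨1 + 13 * (‖e‖ + ‖f‖) / lam, by positivity, fun g h => ?_⟩
  set τ := h.ht - g.ht - ω g.pt h.pt with hτ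
  -- Equal amplitudes keep the length of order `√|τ|`; the sign of `β` sets the orientation.
  obtain ⟨α, β, hα, hβ, hαβ⟩ : ∃ α β : ℝ, |α| = √|τ| ∧ |β| = √|τ| ∧ α * β = τ := by
    rcases le_total 0 τ with h0 | h0
    · refine ⟨√|τ|, √|τ|, abs_of_nonneg (by positivity), abs_of_nonneg (by positivity), ?_⟩
      rw [Real.mul_self_sqrt (abs_nonneg _), abs_of_nonneg h0]
    · refine ⟨√|τ|, -√|τ|, abs_of_nonneg (by positivity),
        by rw [abs_neg, abs_of_nonneg (by positivity)], ?_⟩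
      rw [mul_neg, Real.mul_self_sqrt (abs_nonneg _), abs_of_nonpos h0, neg_neg]
  have hself : ω g.pt g.pt = 0 := by have := hω g.pt g.pt; linarith
  refine (iInf₂_le_of_le _ _ <| iInf_le_of_le
    (isHorizontalCurve_loop hω g.pt (h.pt - g.pt) e f g.ht α β) <| iInf₂_le_of_le ?_ ?_ <|
    eVariationOn_loopCurve_le _ _ _ _ _ _).trans ?_
  · simp [loopCurve, loopHeight]
  · constructor
    · simp only [loopCurve]; norm_num
    · simp only [loopHeight, hαβ, hef, map_sub, hself, hτ]; ring
  · rw [koranyiDist, ← ENNReal.ofReal_mul (by positivity), koranyiNorm_inv_mul_comm hω,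
      koranyiNorm_inv_mul, ← hτ, hα, hβ]
    refine ENNReal.ofReal_le_ofReal ?_
    set N := max ‖h.pt - g.pt‖ (lam * √|τ|) with hN
    have h1 : ‖h.pt - g.pt‖ ≤ N := le_max_left _ _
    have h2 : √|τ| ≤ N / lam := by
      rw [le_div_iff₀ hlam, mul_comm]; exact le_max_right _ _
    calc ‖h.pt - g.pt‖ + √|τ| * 13 * ‖e‖ + √|τ| * 13 * ‖f‖
        = ‖h.pt - g.pt‖ + 13 * (‖e‖ + ‖f‖) * √|τ| := by ring
      _ ≤ N + 13 * (‖e‖ + ‖f‖) * (N / lam) := by gcongr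
      _ = (1 + 13 * (‖e‖ + ‖f‖) / lam) * N := by ring

end Heisenberg

end

theorem theoremC {X : Type*} [NormedAddCommGroup X] [NormedSpace ℝ X] [CompleteSpace X]
    (ω : X →L[ℝ] X →L[ℝ] ℝ) (hω : ∀ x y, ω x y = -ω y x) (p : ℝ) (hp : 2 ≤ p) :
    (∀ C : ℝ, 0 < C → RelaxedUmbelInequality (fun x y : X => edist x y) p C →
      ∀ lam : ℝ, 0 < lam → (∀ x y, lam ^ 2 * |ω x y| ≤ ‖x‖ * ‖y‖) →
        RelaxedUmbelInequality (Heisenberg.koranyiDist (ω := ω) lam) p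
          (max C (2 * (8 : ℝ) ^ (1 / p)))) ∧
    (ω ≠ 0 → HasPropertyBeta X p →
      HasUmbelCotype (Heisenberg.ccDist (ω := ω)) p) := by
  refine ⟨fun C hC hX lam hlam hbd =>
    Heisenberg.relaxedUmbelInequality_koranyiDist hω hp hC hX hlam hbd, fun hω0 hβ => ?_⟩
  have hp0 : 0 ≤ p := by linarith
  obtain ⟨C, hC, hX⟩ := hβ.exists_relaxedUmbelInequality (by linarith)
  obtain ⟨lam, hlam, hlamω⟩ : ∃ lam : ℝ, 0 < lam ∧ lam ^ 2 * ‖ω‖ ≤ 1 := by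
    refine ⟨1 / (‖ω‖ + 1), by positivity, ?_⟩
    rw [div_pow, one_pow, one_div_mul_eq_div, div_le_one (by positivity)]
    nlinarith [norm_nonneg ω]
  have hbd : ∀ x y, lam ^ 2 * |ω x y| ≤ ‖x‖ * ‖y‖ := fun x y =>
    calc lam ^ 2 * |ω x y| ≤ lam ^ 2 * (‖ω‖ * ‖x‖ * ‖y‖) := by
          gcongr; exact ω.le_opNorm₂ x y
      _ = lam ^ 2 * ‖ω‖ * (‖x‖ * ‖y‖) := by ring
      _ ≤ 1 * (‖x‖ * ‖y‖) := by gcongr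
      _ = ‖x‖ * ‖y‖ := one_mul _
  obtain ⟨B, hB, hcc⟩ := Heisenberg.exists_ccDist_le hω hω0 hlam
  refine HasUmbelCotype.of_equivalent hp0 one_pos hB
    ((Heisenberg.relaxedUmbelInequality_koranyiDist hω hp hC hX hlam hbd).hasUmbelCotype
      (fun g h => ?_) hp0 (lt_max_of_lt_left hC)) (fun g h => ?_) hcc
  · rw [Heisenberg.koranyiDist, Heisenberg.koranyiDist, Heisenberg.koranyiNorm_inv_mul_comm hω]
  · rw [ENNReal.ofReal_one, one_mul]
    exact Heisenberg.koranyiDist_le_ccDist hω hlam.le hlamω g h
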